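/- **Setting.** Fix an integer $n\ge 1$. On $\{1,\dots,2n+2\}$ put $i'=2n+3-i$. Let $\bar\imath=0$ for $i=1,1'$ and $\bar\imath=1$ for $i=2,\dots,2'$; let $\theta_i=1$ for $i=1,\dots,n+1,1'$ and $\theta_i=-1$ for $i=n+2,\dots,2'$; and let $\kappa=-n$. The extended Yangian $\mathrm X(\mathfrak{osp}_{2|2n})$ is the ($\mathbb Z_2$-graded) associative unital $\mathbb C$-algebra with generators $t_{ij}^{(r)}$ of parity $\bar\imath+\bar\jmath$ mod $2$ ($1\le i,j\le 2n+2$, $r\ge 1$) and with defining relations, written in terms of $t_{ij}(u)=\delta_{ij}+\sum_{r\ge1}t_{ij}^{(r)}u^{-r}$ and the supercommutator, $$\begin{aligned}{}[t_{ij}(u),t_{kl}(v)]&=\frac{1}{u-v}\big(t_{kj}(u)t_{il}(v)-t_{kj}(v)t_{il}(u)\big)(-1)^{\bar\imath\bar\jmath+\bar\imath\bar k+\bar\jmath\bar k}\\&\quad-\frac1{u-v-\kappa}\Big(\delta_{k i'}\sum_{p=1}^{2n+2}t_{pj}(u)t_{p'l}(v)(-1)^{\bar\imath+\bar\imath\bar\jmath+\bar\jmath\bar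 p}\theta_i\theta_p\\&\qquad\qquad-\delta_{l j'}\sum_{p=1}^{2n+2}t_{kp'}(v)t_{ip}(u)(-1)^{\bar\jmath+\bar p+\bar\imath\bar k+\bar\jmath\bar k+\bar\imath\bar p}\theta_j\theta_p\Big).\end{aligned}$$ Let $T(u)=[t_{ij}(u)]$ and let $T^t(u)$ be the matrix with entries $(T^t(u))_{ij}=t_{j'i'}(u)(-1)^{\bar\imath\bar\jmath+\bar\jmath}\theta_i\theta_j$. The series $c(u)$ with coefficients in $\mathrm X(\mathfrak{osp}_{2|2n})$ is determined by $T(u-\kappa)\,T^t(u)=c(u)\,1$ (the left-hand side is a scalar matrix). A representation $V$ of $\mathrm X(\mathfrak{osp}_{2|2n})$ is a highest weight representation if it is generated by a nonzero vector $\xi$ such that $t_{ij}(u)\xi=0$ for $1\le i<j\le 2n+2$ and $t_{ii}(u)\xi=\lambda_i(u)\xi$ for $i=1,\dots,2n+2$, for some formal series $\lambda_i(u)\in1+u^{-1}\mathbb C[[u^{-1}]]$. **Proposition 2.2.** The series $\lambda_i(u)$ associated with a highest weight representation $V$ of $\mathrm X(\mathfrak{osp}_{2|2n})$ satisfy the consistency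 conditions $$\lambda_i(u)\,\lambda_{i'}(u+n-i+2)=\lambda_{i+1}(u)\,\lambda_{(i+1)'}(u+n-i+2),\qquad i=1,\dots,n.$$ Moreover, the coefficients of the series $c(u)$ act in $V$ as multiplications by the scalars determined by $c(u)\mapsto\lambda_1(u)\,\lambda_{1'}(u+n)$. (Here $f(u+a)$ is expanded as a series in $u^{-1}$.) -/

import Mathlib

open scoped PowerSeries

namespace OspYangian

/-- The index set `{1, 2, …, 2n+2}`, numbered from `0`: the element `i` of `Fin (2n+2)` stands
for the index `i + 1`. The involution `i ↦ i' = 2n - i + 3` becomes `Fin.rev`. -/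
abbrev Idx (n : ℕ) : Type := Fin (2 * n + 2)

/-- The parity of an index: `0` for `1` and `1'` (first and last), `1` for `2, …, 2'`. -/
def par {n : ℕ} (i : Idx n) : ℕ :=
  if (i : ℕ) = 0 ∨ (i : ℕ) = 2 * n + 1 then 0 else 1

/-- `θ_i = 1` for `i = 1, …, n+1, 1'` and `θ_i = -1` for `i = n+2, …, 2'`. -/
def theta {n : ℕ} (i : Idx n) : ℤ :=
  if (i : ℕ) ≤ n ∨ (i : ℕ) = 2 * n + 1 then 1 else -1

/-- The parameter `κ = -n` of the `R`-matrix. -/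
def kappa (n : ℕ) : ℂ := -(n : ℂ)

section Series

/- A series in `u⁻¹` over `A` is an element of `A⟦X⟧`, the variable `X` being `u⁻¹`.
A series in `u⁻¹` and `v⁻¹` is an element of `A⟦X⟧⟦X⟧`: the variable of the inner ring `A⟦X⟧`
is `u⁻¹` and the outer variable is `v⁻¹`. -/
variable {A : Type*} [Ring A] [Algebra ℂ A]

/-- The series `f(u)` as a series in two variables. -/
noncomputable def inU (f : A⟦X⟧) : A⟦X⟧⟦X⟧ := PowerSeries.C f

/-- The series `f(v)` as a series in two variables. -/
noncomputable def inV (f : A⟦X⟧) : A⟦X⟧⟦X⟧ := PowerSeries.map PowerSeries.C f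

variable (A) in
/-- The variable `u⁻¹`. -/
noncomputable def uInv : A⟦X⟧⟦X⟧ := inU PowerSeries.X

variable (A) in
/-- The variable `v⁻¹`. -/
noncomputable def vInv : A⟦X⟧⟦X⟧ := inV PowerSeries.X

/-- `f(u) ↦ f(u + a)`: as `(u + a)⁻¹ = u⁻¹ / (1 + a u⁻¹)`, the series `∑ f_r u⁻ʳ` goes to
`∑ f_r (u⁻¹ (1 + a u⁻¹)⁻¹)ʳ`, expanded in powers of `u⁻¹`. The terms with `r > m` do not
contribute to the coefficient of `u⁻ᵐ`. -/
noncomputable def shift (a : ℂ) (f : A⟦X⟧) : A⟦X⟧ :=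
  PowerSeries.mk fun m => ∑ r ∈ Finset.range (m + 1),
    PowerSeries.coeff m
      (((PowerSeries.X : ℂ⟦X⟧) * (1 + PowerSeries.C a * PowerSeries.X)⁻¹) ^ r) •
        PowerSeries.coeff r f

variable {n : ℕ}

/-- The left-hand side of the defining relation for the indices `i, j, k, l`, multiplied by
`(u - v)(u - v - κ) u⁻² v⁻²`. In terms of `x = u⁻¹`, `y = v⁻¹` one has
`(u - v) x y = y - x` and `(u - v - κ) x y = y - x - κ x y`; the bracket is the
supercommutator of `t_ij(u)` and `t_kl(v)`, of parities `i + j` and `k + l`. -/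
noncomputable def relLHS (t : Idx n → Idx n → A⟦X⟧) (i j k l : Idx n) : A⟦X⟧⟦X⟧ :=
  let x := uInv A
  let y := vInv A
  (y - x) * (y - x - kappa n • (x * y)) *
    (inU (t i j) * inV (t k l)
      - ((-1 : ℤ) ^ ((par i + par j) * (par k + par l))) • (inV (t k l) * inU (t i j)))

/-- The right-hand side of the defining relation for the indices `i, j, k, l`, that is
`1/(u-v) (t_kj(u) t_il(v) - t_kj(v) t_il(u)) (-1)^(ij+ik+jk)
  - 1/(u-v-κ) (δ_{k,i'} ∑_p t_pj(u) t_p'l(v) (-1)^(i+ij+jp) θ_i θ_p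
      - δ_{l,j'} ∑_p t_kp'(v) t_ip(u) (-1)^(j+p+ik+jk+ip) θ_j θ_p)`
(with parities in the exponents), multiplied by `(u - v)(u - v - κ) u⁻² v⁻²`. -/
noncomputable def relRHS (t : Idx n → Idx n → A⟦X⟧) (i j k l : Idx n) : A⟦X⟧⟦X⟧ :=
  let x := uInv A
  let y := vInv A
  x * y * (y - x - kappa n • (x * y)) *
      (((-1 : ℤ) ^ (par i * par j + par i * par k + par j * par k)) •
        (inU (t k j) * inV (t i l) - inV (t k j) * inU (t i l)))
    - x * y * (y - x) *
      ((if k = i.rev then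
          ∑ p : Idx n, ((-1 : ℤ) ^ (par i + par i * par j + par j * par p) * theta i * theta p) •
            (inU (t p j) * inV (t p.rev l))
        else 0)
      - (if l = j.rev then
          ∑ p : Idx n, ((-1 : ℤ) ^ (par j + par p + par i * par k + par j * par k
              + par i * par p) * theta j * theta p) •
            (inV (t k p.rev) * inU (t i p))
        else 0))

end Series

/-- The free algebra on the symbols `t_ij^(r)`, `r ≥ 1`; the triple `(i, j, r)` with `r ≥ 0`
stands for `t_ij^(r+1)`. -/
abbrev FreeAlg (n : ℕ) : Type := FreeAlgebra ℂ (Idx n × Idx n × ℕ)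

/-- `t_ij(u) = δ_ij + ∑_{r ≥ 1} t_ij^(r) u⁻ʳ` over the free algebra. -/
noncomputable def freeT (n : ℕ) (i j : Idx n) : (FreeAlg n)⟦X⟧ :=
  PowerSeries.mk fun r => match r with
    | 0 => if i = j then 1 else 0
    | r + 1 => FreeAlgebra.ι ℂ (i, j, r)

/-- The defining relations: the coefficients of all `u⁻ʳ v⁻ˢ` on both sides agree. -/
inductive Rel (n : ℕ) : FreeAlg n → FreeAlg n → Prop
  | rtt (i j k l : Idx n) (r s : ℕ) :
      Rel n
        (PowerSeries.coeff r (PowerSeries.coeff s (relLHS (freeT n) i j k l)))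
        (PowerSeries.coeff r (PowerSeries.coeff s (relRHS (freeT n) i j k l)))

/-- The extended Yangian `X(osp_{2|2n})` as an associative algebra over `ℂ`. -/
abbrev ExtYangian (n : ℕ) : Type := RingQuot (Rel n)

/-- The matrix `T(u) = [t_ij(u)]` over `X(osp_{2|2n})[[u⁻¹]]`. -/
noncomputable def T (n : ℕ) : Matrix (Idx n) (Idx n) (ExtYangian n)⟦X⟧ :=
  fun i j => PowerSeries.map (RingQuot.mkAlgHom ℂ (Rel n)).toRingHom (freeT n i j)

/-- The matrix super-transposition `(A^t)_ij = A_{j'i'} (-1)^(ij+j) θ_i θ_j`. -/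
def superTranspose {n : ℕ} {R : Type*} [Ring R] (A : Matrix (Idx n) (Idx n) R) :
    Matrix (Idx n) (Idx n) R :=
  fun i j => ((-1 : ℤ) ^ (par i * par j + par j) * theta i * theta j) • A j.rev i.rev

/-- `ξ` is a highest vector of the `X(osp_{2|2n})`-module `V` (which it generates) with the
associated series `λ_1(u), …, λ_{2n+2}(u)`. -/
structure IsHighestVector {n : ℕ} {V : Type*} [AddCommGroup V] [Module ℂ V]
    [Module (ExtYangian n) V] (ξ : V) (lam : Idx n → ℂ⟦X⟧) : Prop where
  ne_zero : ξ ≠ 0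
  span_eq_top : Submodule.span (ExtYangian n) {ξ} = ⊤
  raising : ∀ i j : Idx n, i < j → ∀ r : ℕ, PowerSeries.coeff r (T n i j) • ξ = 0
  diag : ∀ (i : Idx n) (r : ℕ),
    PowerSeries.coeff r (T n i i) • ξ = PowerSeries.coeff r (lam i) • ξ
  constantCoeff_eq_one : ∀ i : Idx n, PowerSeries.constantCoeff (lam i) = 1

/-- The index `i`, where `1 ≤ i ≤ 2n+2`. -/
def idx {n : ℕ} (i : ℕ) (hi : 1 ≤ i ∧ i ≤ 2 * n + 2) : Idx n := ⟨i - 1, by omega⟩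

end OspYangian

set_option linter.unusedSectionVars false

/-! Both claims come from evaluating the defining relation where a factor u - v - c vanishes. Such
factors are cancellable (`delta_mul_cancel`), so denominators can stay cleared throughout.

At v = u - κ only the two sums carrying the pole u - v = κ survive, and they must agree. This makes
T(u - κ) T^t(u) scalar, with c(u) = ∑ θ_p t_{p1}(u) t_{p'1'}(u - κ) (`sum_mul_superTranspose`). To
see that c(v) is central, write it as the (k,k) entry with k ≠ i, i' and move t_ij(u) through both
factors: the correction terms cancel in pairs because off-diagonal entries of the product vanish
(`commute_centralSeries`). On ξ only p = 1 survives in c(u), giving λ_1(u) λ_{1'}(u + n), and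
centrality carries this scalar to the whole cyclic module.

For the consistency conditions, apply the relations between t_pq(u) and t_{p'q'}(v), p, q ≤ n + 1,
to ξ and pair with a functional φ such that φ(ξ) = 1. Many terms end in a raising operator and
vanish; what is left is a linear recurrence over a commutative domain (`recurrence_consequence`),
whose solution gives (u - v - κ - i + 2) φ(t_{i,i+1}(u) t_{i',(i+1)'}(v) ξ) = λ_{i+1}(u)
λ_{(i+1)'}(v) - λ_i(u) λ_{i'}(v). The left side vanishes at v = u + n - i + 2. -/

namespace OspYangian

/-! ### Series in two variables: pairing, exchange and specialization -/

section TwoVariables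

variable {A : Type*} [Ring A] [Algebra ℂ A]

theorem coeff_complex_smul (k : ℂ) (f : A⟦X⟧) (r : ℕ) :
    PowerSeries.coeff r (k • f) = k • PowerSeries.coeff r f := rfl

theorem coeff_coeff_inU_mul_inV (f g : A⟦X⟧) (r s : ℕ) :
    PowerSeries.coeff r (PowerSeries.coeff s (inU f * inV g)) =
      PowerSeries.coeff r f * PowerSeries.coeff s g := by
  simp [inU, inV, PowerSeries.coeff_C_mul, PowerSeries.coeff_mul_C]

theorem coeff_coeff_inV_mul_inU (f g : A⟦X⟧) (r s : ℕ) :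
    PowerSeries.coeff r (PowerSeries.coeff s (inV g * inU f)) =
      PowerSeries.coeff s g * PowerSeries.coeff r f := by
  simp [inU, inV, PowerSeries.coeff_C_mul, PowerSeries.coeff_mul_C]

theorem vInv_eq_X : vInv A = PowerSeries.X := by
  simp [vInv, inV]

theorem uInv_comm (F : A⟦X⟧⟦X⟧) : F * uInv A = uInv A * F := by
  ext s r
  simp [uInv, inU, PowerSeries.coeff_C_mul, PowerSeries.coeff_mul_C,
    (PowerSeries.commute_X _).eq]

theorem vInv_comm (F : A⟦X⟧⟦X⟧) : F * vInv A = vInv A * F := by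
  rw [vInv_eq_X]; exact (PowerSeries.commute_X F).eq

variable (A) in
/-- The series `(u - v - c) u⁻¹ v⁻¹`. -/
noncomputable def delta (c : ℂ) : A⟦X⟧⟦X⟧ := vInv A - uInv A - c • (uInv A * vInv A)

theorem uv_comm (F : A⟦X⟧⟦X⟧) : F * (uInv A * vInv A) = uInv A * vInv A * F := by
  rw [← mul_assoc, uInv_comm, mul_assoc, vInv_comm, mul_assoc]

theorem delta_comm (c : ℂ) (F : A⟦X⟧⟦X⟧) : F * delta A c = delta A c * F := by
  rw [delta, mul_sub, mul_sub, sub_mul, sub_mul, uInv_comm, vInv_comm, mul_smul_comm,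
    smul_mul_assoc, uv_comm]

theorem delta_mul (c : ℂ) (F : A⟦X⟧⟦X⟧) :
    delta A c * F = vInv A * F - uInv A * F - c • (uInv A * (vInv A * F)) := by
  simp only [delta, sub_mul, smul_mul_assoc, mul_assoc]

/-- The coefficient of v⁻ˢ in the product is -u⁻¹ F_s plus a multiple of F_{s-1}, so the F_s vanish
by induction on s. -/
theorem delta_mul_cancel {c : ℂ} {F : A⟦X⟧⟦X⟧} (h : delta A c * F = 0) : F = 0 := by
  have hX : ∀ f : A⟦X⟧, PowerSeries.X * f = 0 → f = 0 := fun f hf => by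
    ext r
    simpa [PowerSeries.coeff_succ_X_mul] using congrArg (PowerSeries.coeff (r + 1)) hf
  ext1 s
  rw [map_zero]
  rw [delta_mul, vInv_eq_X] at h
  induction s with
  | zero =>
    have := congrArg (PowerSeries.coeff 0) h
    apply hX
    simpa [uInv, inU, PowerSeries.coeff_C_mul] using this
  | succ s ih =>
    have := congrArg (PowerSeries.coeff (s + 1)) h
    apply hX
    simpa [uInv, inU, PowerSeries.coeff_C_mul, PowerSeries.coeff_succ_X_mul, ih] using this

/-- The coefficientwise application of a linear map. -/
noncomputable def mapCoeff (ψ : A →ₗ[ℂ] ℂ) (F : A⟦X⟧⟦X⟧) : ℂ⟦X⟧⟦X⟧ :=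
  PowerSeries.mk fun s => PowerSeries.mk fun r =>
    ψ (PowerSeries.coeff r (PowerSeries.coeff s F))

section mapCoeff

variable (ψ : A →ₗ[ℂ] ℂ)

theorem mapCoeff_sub (F G : A⟦X⟧⟦X⟧) :
    mapCoeff ψ (F - G) = mapCoeff ψ F - mapCoeff ψ G := by
  ext s r; simp [mapCoeff]

theorem mapCoeff_sum {ι : Type*} (t : Finset ι) (F : ι → A⟦X⟧⟦X⟧) :
    mapCoeff ψ (∑ i ∈ t, F i) = ∑ i ∈ t, mapCoeff ψ (F i) := by
  ext s r; simp [mapCoeff]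

theorem mapCoeff_zsmul (k : ℤ) (F : A⟦X⟧⟦X⟧) : mapCoeff ψ (k • F) = k • mapCoeff ψ F := by
  ext s r; simp [mapCoeff, -zsmul_eq_mul]

theorem mapCoeff_smul (k : ℂ) (F : A⟦X⟧⟦X⟧) : mapCoeff ψ (k • F) = k • mapCoeff ψ F := by
  ext s r; simp [mapCoeff]

theorem mapCoeff_uInv_mul (F : A⟦X⟧⟦X⟧) : mapCoeff ψ (uInv A * F) = uInv ℂ * mapCoeff ψ F := by
  ext s r
  cases r <;>
    simp [mapCoeff, uInv, inU, PowerSeries.coeff_C_mul, PowerSeries.coeff_succ_X_mul,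
      PowerSeries.coeff_zero_X_mul]

theorem mapCoeff_vInv_mul (F : A⟦X⟧⟦X⟧) : mapCoeff ψ (vInv A * F) = vInv ℂ * mapCoeff ψ F := by
  ext s r
  cases s <;> simp [mapCoeff, vInv_eq_X, PowerSeries.coeff_succ_X_mul]

theorem mapCoeff_delta_mul (c : ℂ) (F : A⟦X⟧⟦X⟧) :
    mapCoeff ψ (delta A c * F) = delta ℂ c * mapCoeff ψ F := by
  simp only [delta_mul, mapCoeff_sub, mapCoeff_smul, mapCoeff_uInv_mul, mapCoeff_vInv_mul]

end mapCoeff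

/-- The exchange of the variables `u` and `v`. -/
noncomputable def swap (F : A⟦X⟧⟦X⟧) : A⟦X⟧⟦X⟧ :=
  PowerSeries.mk fun s => PowerSeries.mk fun r =>
    PowerSeries.coeff s (PowerSeries.coeff r F)

theorem swap_sub (F G : A⟦X⟧⟦X⟧) : swap (F - G) = swap F - swap G := by
  ext s r; simp [swap]

theorem swap_zero : swap (0 : A⟦X⟧⟦X⟧) = 0 := by
  ext s r; simp [swap]

theorem swap_sum {ι : Type*} (t : Finset ι) (F : ι → A⟦X⟧⟦X⟧) :
    swap (∑ i ∈ t, F i) = ∑ i ∈ t, swap (F i) := by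
  ext s r; simp [swap]

theorem swap_zsmul (k : ℤ) (F : A⟦X⟧⟦X⟧) : swap (k • F) = k • swap F := by
  ext s r; simp [swap, -zsmul_eq_mul]

theorem swap_smul (k : ℂ) (F : A⟦X⟧⟦X⟧) : swap (k • F) = k • swap F := by
  ext s r; simp [swap]

theorem swap_uInv_mul (F : A⟦X⟧⟦X⟧) : swap (uInv A * F) = vInv A * swap F := by
  ext s r
  cases s <;>
    simp [swap, vInv_eq_X, uInv, inU, PowerSeries.coeff_C_mul, PowerSeries.coeff_succ_X_mul]

theorem swap_vInv_mul (F : A⟦X⟧⟦X⟧) : swap (vInv A * F) = uInv A * swap F := by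
  ext s r
  cases r <;>
    simp [swap, vInv_eq_X, uInv, inU, PowerSeries.coeff_C_mul, PowerSeries.coeff_succ_X_mul]

theorem swap_delta_mul (c : ℂ) (F : A⟦X⟧⟦X⟧) :
    swap (delta A c * F) = -(delta A (-c) * swap F) := by
  simp only [delta_mul, swap_sub, swap_smul, swap_uInv_mul, swap_vInv_mul]
  rw [← mul_assoc (vInv A), uInv_comm (vInv A), mul_assoc (uInv A)]
  module

theorem swap_uv_mul (F : A⟦X⟧⟦X⟧) :
    swap (uInv A * vInv A * F) = uInv A * vInv A * swap F := by
  rw [mul_assoc, swap_uInv_mul, swap_vInv_mul, ← mul_assoc, uInv_comm (vInv A)]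

theorem swap_inU_mul_inV (f g : A⟦X⟧) : swap (inU f * inV g) = inV f * inU g := by
  ext s r
  simp only [swap, PowerSeries.coeff_mk, coeff_coeff_inU_mul_inV, coeff_coeff_inV_mul_inU]

theorem swap_inV_mul_inU (f g : A⟦X⟧) : swap (inV f * inU g) = inU f * inV g := by
  ext s r
  simp only [swap, PowerSeries.coeff_mk, coeff_coeff_inU_mul_inV, coeff_coeff_inV_mul_inU]

/-- The specialization `v = u`. -/
noncomputable def diag (F : A⟦X⟧⟦X⟧) : A⟦X⟧ :=
  PowerSeries.mk fun m => ∑ p ∈ Finset.HasAntidiagonal.antidiagonal m,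
    PowerSeries.coeff p.1 (PowerSeries.coeff p.2 F)

theorem diag_sub (F G : A⟦X⟧⟦X⟧) : diag (F - G) = diag F - diag G := by
  ext s; simp [diag]

theorem diag_zero : diag (0 : A⟦X⟧⟦X⟧) = 0 := by
  ext s; simp [diag]

theorem diag_sum {ι : Type*} (t : Finset ι) (F : ι → A⟦X⟧⟦X⟧) :
    diag (∑ i ∈ t, F i) = ∑ i ∈ t, diag (F i) := by
  ext s
  simp only [diag, PowerSeries.coeff_mk, map_sum]
  exact Finset.sum_comm

theorem diag_zsmul (k : ℤ) (F : A⟦X⟧⟦X⟧) : diag (k • F) = k • diag F := by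
  ext s; simp [diag, Finset.smul_sum, -zsmul_eq_mul]

theorem diag_smul (k : ℂ) (F : A⟦X⟧⟦X⟧) : diag (k • F) = k • diag F := by
  ext s; simp [diag, Finset.smul_sum]

theorem diag_uInv_mul (F : A⟦X⟧⟦X⟧) : diag (uInv A * F) = PowerSeries.X * diag F := by
  ext m
  cases m with
  | zero => simp [diag, uInv, inU]
  | succ m =>
    simp [diag, uInv, inU, PowerSeries.coeff_C_mul, PowerSeries.coeff_succ_X_mul,
      Finset.Nat.sum_antidiagonal_succ]

theorem diag_vInv_mul (F : A⟦X⟧⟦X⟧) : diag (vInv A * F) = PowerSeries.X * diag F := by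
  ext m
  cases m with
  | zero => simp [diag, vInv_eq_X]
  | succ m =>
    simp [diag, vInv_eq_X, PowerSeries.coeff_succ_X_mul, Finset.Nat.sum_antidiagonal_succ']

theorem diag_delta_mul (c : ℂ) (F : A⟦X⟧⟦X⟧) :
    diag (delta A c * F) = -c • (PowerSeries.X * (PowerSeries.X * diag F)) := by
  simp only [delta_mul, diag_sub, diag_smul, diag_uInv_mul, diag_vInv_mul]
  module

theorem diag_uv_mul (F : A⟦X⟧⟦X⟧) :
    diag (uInv A * vInv A * F) = PowerSeries.X * (PowerSeries.X * diag F) := by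
  rw [mul_assoc, diag_uInv_mul, diag_vInv_mul]

theorem diag_inU_mul_inV (f g : A⟦X⟧) : diag (inU f * inV g) = f * g := by
  ext m
  rw [PowerSeries.coeff_mul]
  simp only [diag, PowerSeries.coeff_mk, coeff_coeff_inU_mul_inV]

theorem diag_inV_mul_inU (f g : A⟦X⟧) : diag (inV g * inU f) = g * f := by
  ext m
  rw [PowerSeries.coeff_mul]
  simp only [diag, PowerSeries.coeff_mk, coeff_coeff_inV_mul_inU]
  rw [← Finset.Nat.sum_antidiagonal_swap]
  rfl

theorem X_mul_cancel {f : A⟦X⟧} (h : PowerSeries.X * f = 0) : f = 0 := by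
  ext r
  simpa [PowerSeries.coeff_succ_X_mul] using congrArg (PowerSeries.coeff (r + 1)) h

/-! ### The substitution v ↦ v + a -/

section shift

variable (a : ℂ)

theorem shift_sub (f g : A⟦X⟧) : shift a (f - g) = shift a f - shift a g := by
  ext s; simp [shift, smul_sub]

theorem shift_zero : shift a (0 : A⟦X⟧) = 0 := by
  ext s; simp [shift]

theorem shift_sum {ι : Type*} (t : Finset ι) (f : ι → A⟦X⟧) :
    shift a (∑ i ∈ t, f i) = ∑ i ∈ t, shift a (f i) := by
  ext s
  simp only [shift, PowerSeries.coeff_mk, map_sum, Finset.smul_sum]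
  exact Finset.sum_comm

theorem shift_zsmul (k : ℤ) (f : A⟦X⟧) : shift a (k • f) = k • shift a f := by
  ext s
  simp only [shift, PowerSeries.coeff_mk, map_zsmul, Finset.smul_sum]
  exact Finset.sum_congr rfl fun _ _ => smul_comm _ _ _

theorem shift_smul (k : ℂ) (f : A⟦X⟧) : shift a (k • f) = k • shift a f := by
  ext s
  simp only [shift, PowerSeries.coeff_mk, coeff_complex_smul, Finset.smul_sum]
  exact Finset.sum_congr rfl fun _ _ => smul_comm _ _ _

theorem shift_C_mul (b : A) (f : A⟦X⟧) :
    shift a (PowerSeries.C b * f) = PowerSeries.C b * shift a f := by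
  ext s
  simp [shift, PowerSeries.coeff_C_mul, Finset.mul_sum]

theorem shift_mul_C (b : A) (f : A⟦X⟧) :
    shift a (f * PowerSeries.C b) = shift a f * PowerSeries.C b := by
  ext s
  simp [shift, PowerSeries.coeff_mul_C, Finset.sum_mul]

theorem coeff_shift_of_le (f : A⟦X⟧) {m N : ℕ} (h : m + 1 ≤ N) :
    PowerSeries.coeff m (shift a f) = ∑ r ∈ Finset.range N,
      PowerSeries.coeff m
        (((PowerSeries.X : ℂ⟦X⟧) * (1 + PowerSeries.C a * PowerSeries.X)⁻¹) ^ r) •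
        PowerSeries.coeff r f := by
  rw [shift, PowerSeries.coeff_mk]
  refine Finset.sum_subset (Finset.range_subset_range.2 h) fun r _ hr => ?_
  rw [mul_pow, PowerSeries.coeff_X_pow_mul', if_neg, zero_smul]
  simpa using hr

/-- The image w of X satisfies (1 + aX) w = X; multiplying by wʳ gives the claim term by term. This,
with linearity over constants, replaces multiplicativity of `shift`. -/
theorem shift_X_mul (f : A⟦X⟧) :
    shift a (PowerSeries.X * f) + a • (PowerSeries.X * shift a (PowerSeries.X * f)) =
      PowerSeries.X * shift a f := by
  set w : ℂ⟦X⟧ := PowerSeries.X * (1 + PowerSeries.C a * PowerSeries.X)⁻¹ with hw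
  have hw' : w + a • (PowerSeries.X * w) = PowerSeries.X := by
    have : (1 + PowerSeries.C a * PowerSeries.X) * (1 + PowerSeries.C a * PowerSeries.X)⁻¹ =
        (1 : ℂ⟦X⟧) := PowerSeries.mul_inv_cancel _ (by simp)
    rw [hw, PowerSeries.smul_eq_C_mul]
    linear_combination PowerSeries.X * this
  have key : ∀ r, w ^ (r + 1) + a • (PowerSeries.X * w ^ (r + 1)) = PowerSeries.X * w ^ r := by
    intro r
    calc _ = (w + a • (PowerSeries.X * w)) * w ^ r := by
          rw [add_mul, smul_mul_assoc]; ring_nf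
      _ = _ := by rw [hw']
  ext m
  cases m with
  | zero => simp [shift]
  | succ m =>
    -- Padding the summation ranges by vanishing terms lets the three sums align once the r = 0
    -- terms, zero for X * f, are split off.
    rw [map_add, coeff_complex_smul, PowerSeries.coeff_succ_X_mul, PowerSeries.coeff_succ_X_mul,
      coeff_shift_of_le a _ (le_refl (m + 2)), coeff_shift_of_le a _ (show m + 1 ≤ m + 2 by omega),
      coeff_shift_of_le a f (le_refl (m + 1)), ← hw, Finset.sum_range_succ' _ (m + 1),
      Finset.sum_range_succ' _ (m + 1), PowerSeries.coeff_zero_X_mul, smul_zero, smul_zero,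
      add_zero, add_zero, Finset.smul_sum, ← Finset.sum_add_distrib]
    refine Finset.sum_congr rfl fun r _ => ?_
    rw [PowerSeries.coeff_succ_X_mul, smul_smul, ← add_smul]
    congr 1
    have := congrArg (PowerSeries.coeff (m + 1)) (key r)
    simpa [PowerSeries.coeff_succ_X_mul] using this

theorem shift_inV (f : A⟦X⟧) : shift a (inV f) = inV (shift a f) := by
  ext s r
  simp only [shift, inV, PowerSeries.coeff_mk, PowerSeries.coeff_map, map_sum]
  rw [← map_sum, ← map_sum]
  simp only [map_sum]
  refine Finset.sum_congr rfl fun i _ => ?_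
  rw [coeff_complex_smul, PowerSeries.coeff_C, PowerSeries.coeff_C]
  split_ifs <;> simp

theorem shift_inU_mul_inV (f g : A⟦X⟧) :
    shift a (inU f * inV g) = inU f * inV (shift a g) := by
  rw [inU, shift_C_mul, shift_inV]

theorem shift_inV_mul_inU (f g : A⟦X⟧) :
    shift a (inV g * inU f) = inV (shift a g) * inU f := by
  rw [inU, shift_mul_C, shift_inV]

theorem shift_uInv_mul (F : A⟦X⟧⟦X⟧) : shift a (uInv A * F) = uInv A * shift a F := by
  rw [uInv, inU, shift_C_mul]

variable (A) in
/-- The series `(v + a) v⁻¹`. -/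
noncomputable def nu : A⟦X⟧⟦X⟧ := 1 + a • vInv A

theorem nu_comm (F : A⟦X⟧⟦X⟧) : F * nu A a = nu A a * F := by
  simp [nu, mul_add, add_mul, vInv_comm]

theorem nu_mul_shift_vInv_mul (F : A⟦X⟧⟦X⟧) :
    nu A a * shift a (vInv A * F) = vInv A * shift a F := by
  rw [nu, add_mul, one_mul, smul_mul_assoc, vInv_eq_X, shift_X_mul]

theorem nu_mul_shift_uv_mul (F : A⟦X⟧⟦X⟧) :
    nu A a * shift a (uInv A * vInv A * F) = uInv A * vInv A * shift a F := by
  rw [mul_assoc, shift_uInv_mul, ← mul_assoc, ← nu_comm _ (uInv A), mul_assoc, nu_mul_shift_vInv_mul,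
    mul_assoc]

/-- Since v⁻¹ becomes v⁻¹ / (1 + a v⁻¹), one factor `nu` clears the denominator, and u - v - c turns
into u - v - (c + a). -/
theorem nu_mul_shift_delta_mul (c : ℂ) (F : A⟦X⟧⟦X⟧) :
    nu A a * shift a (delta A c * F) = delta A (c + a) * shift a F := by
  rw [delta_mul, shift_sub, shift_sub, shift_smul, mul_sub, mul_sub, mul_smul_comm,
    shift_uInv_mul, shift_uInv_mul, ← mul_assoc _ (uInv A), ← mul_assoc _ (uInv A), ← nu_comm _ (uInv A),
    mul_assoc (uInv A), mul_assoc (uInv A), nu_mul_shift_vInv_mul, delta_mul, nu, add_mul,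
    one_mul, smul_mul_assoc, mul_add, mul_smul_comm]
  module

end shift

end TwoVariables

/-! ### The defining relation and its shifted, specialized and exchanged forms -/

section Relations

variable {A : Type*} [Ring A] [Algebra ℂ A] {n : ℕ}

theorem par_eq_zero_or_one (i : Idx n) : par i = 0 ∨ par i = 1 := by
  unfold par; split_ifs <;> simp

theorem par_rev (i : Idx n) : par i.rev = par i := by
  unfold par
  have := i.isLt
  simp only [Fin.val_rev]
  congr 1
  simp only [eq_iff_iff]
  omega

theorem theta_eq_one_or_neg_one (i : Idx n) : theta i = 1 ∨ theta i = -1 := by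
  unfold theta; split_ifs <;> simp

theorem theta_rev (i : Idx n) : theta i.rev = (-1) ^ par i * theta i := by
  have := i.isLt
  unfold par theta
  simp only [Fin.val_rev]
  split_ifs <;> omega

/-- The term of the defining relation coming from `T^t(u) T(v)`. -/
noncomputable def crossLeft (t s : Idx n → Idx n → A⟦X⟧) (i j k l : Idx n) : A⟦X⟧⟦X⟧ :=
  if k = i.rev then
    ∑ p : Idx n, ((-1 : ℤ) ^ (par i + par i * par j + par j * par p) * theta i * theta p) •
      (inU (t p j) * inV (s p.rev l))
  else 0

/-- The term of the defining relation coming from `T(v) T^t(u)`. -/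
noncomputable def crossRight (t s : Idx n → Idx n → A⟦X⟧) (i j k l : Idx n) : A⟦X⟧⟦X⟧ :=
  if l = j.rev then
    ∑ p : Idx n, ((-1 : ℤ) ^ (par j + par p + par i * par k + par j * par k
        + par i * par p) * theta j * theta p) • (inV (s k p.rev) * inU (t i p))
  else 0

/-- The supercommutator of `t_ij(u)` and `s_kl(v)`. -/
noncomputable def superComm (t s : Idx n → Idx n → A⟦X⟧) (i j k l : Idx n) : A⟦X⟧⟦X⟧ :=
  inU (t i j) * inV (s k l)
    - ((-1 : ℤ) ^ ((par i + par j) * (par k + par l))) • (inV (s k l) * inU (t i j))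

/-- The term of the defining relation coming from the permutation operator. -/
noncomputable def permTerm (t s : Idx n → Idx n → A⟦X⟧) (i j k l : Idx n) : A⟦X⟧⟦X⟧ :=
  ((-1 : ℤ) ^ (par i * par j + par i * par k + par j * par k)) •
    (inU (t k j) * inV (s i l) - inV (s k j) * inU (t i l))

/-- The defining relations of the extended Yangian, for a matrix over an arbitrary algebra. -/
def SatisfiesRTT (t : Idx n → Idx n → A⟦X⟧) : Prop :=
  ∀ i j k l, relLHS t i j k l = relRHS t i j k l

variable {t : Idx n → Idx n → A⟦X⟧}

theorem SatisfiesRTT.rel (h : SatisfiesRTT t) (i j k l : Idx n) :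
    delta A 0 * (delta A (kappa n) * superComm t t i j k l) =
      uInv A * vInv A * (delta A (kappa n) * permTerm t t i j k l) -
        uInv A * vInv A * (delta A 0 * (crossLeft t t i j k l - crossRight t t i j k l)) := by
  have := h i j k l
  simp only [relLHS, relRHS] at this
  simpa only [delta, zero_smul, sub_zero, superComm, permTerm, crossLeft, crossRight,
    mul_assoc] using this

theorem shift_superComm (a : ℂ) (s : Idx n → Idx n → A⟦X⟧) (i j k l : Idx n) :
    shift a (superComm t s i j k l) = superComm t (fun i j => shift a (s i j)) i j k l := by
  simp only [superComm, shift_sub, shift_zsmul, shift_inU_mul_inV, shift_inV_mul_inU]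

theorem shift_permTerm (a : ℂ) (s : Idx n → Idx n → A⟦X⟧) (i j k l : Idx n) :
    shift a (permTerm t s i j k l) = permTerm t (fun i j => shift a (s i j)) i j k l := by
  simp only [permTerm, shift_sub, shift_zsmul, shift_inU_mul_inV, shift_inV_mul_inU]

theorem shift_crossLeft (a : ℂ) (s : Idx n → Idx n → A⟦X⟧) (i j k l : Idx n) :
    shift a (crossLeft t s i j k l) = crossLeft t (fun i j => shift a (s i j)) i j k l := by
  unfold crossLeft
  split_ifs
  · simp only [shift_sum, shift_zsmul, shift_inU_mul_inV]
  · exact shift_zero a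

theorem shift_crossRight (a : ℂ) (s : Idx n → Idx n → A⟦X⟧) (i j k l : Idx n) :
    shift a (crossRight t s i j k l) = crossRight t (fun i j => shift a (s i j)) i j k l := by
  unfold crossRight
  split_ifs
  · simp only [shift_sum, shift_zsmul, shift_inV_mul_inU]
  · exact shift_zero a

theorem nu_sq_mul_shift_delta_mul (a c d : ℂ) (F : A⟦X⟧⟦X⟧) :
    nu A a * (nu A a * shift a (delta A c * (delta A d * F))) =
      delta A (c + a) * (delta A (d + a) * shift a F) := by
  rw [nu_mul_shift_delta_mul, ← mul_assoc, ← nu_comm _ (delta A _), mul_assoc,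
    nu_mul_shift_delta_mul]

theorem nu_sq_mul_shift_uv_mul (a c : ℂ) (F : A⟦X⟧⟦X⟧) :
    nu A a * (nu A a * shift a (uInv A * vInv A * (delta A c * F))) =
      uInv A * vInv A * (delta A (c + a) * shift a F) := by
  rw [nu_mul_shift_uv_mul, ← mul_assoc (nu A a), ← nu_comm _ (uInv A * vInv A), mul_assoc _ (nu A a),
    nu_mul_shift_delta_mul]

/-- The defining relation between `T(u)` and `T(v + a)`. -/
theorem SatisfiesRTT.rel_shift (h : SatisfiesRTT t) (a : ℂ) (i j k l : Idx n) :
    delta A a * (delta A (kappa n + a) * superComm t (fun i j => shift a (t i j)) i j k l) =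
      uInv A * vInv A * (delta A (kappa n + a) *
          permTerm t (fun i j => shift a (t i j)) i j k l) -
        uInv A * vInv A * (delta A a * (crossLeft t (fun i j => shift a (t i j)) i j k l -
          crossRight t (fun i j => shift a (t i j)) i j k l)) := by
  have := congrArg (fun F => nu A a * (nu A a * shift a F)) (h.rel i j k l)
  simpa only [shift_sub, mul_sub (nu A a), nu_sq_mul_shift_delta_mul, nu_sq_mul_shift_uv_mul,
    shift_superComm, shift_permTerm, shift_crossLeft, shift_crossRight, zero_add] using this

/-- The specialization `v = u - κ` of the defining relation. -/
theorem SatisfiesRTT.diag_cross (h : SatisfiesRTT t) (hn : 1 ≤ n) (i j k l : Idx n) :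
    diag (crossLeft t (fun i j => shift (-kappa n) (t i j)) i j k l) =
      diag (crossRight t (fun i j => shift (-kappa n) (t i j)) i j k l) := by
  -- With a = -κ the factor u - v - κ becomes u - v and dies on the diagonal, together with the
  -- supercommutator and the permutation term. The cross terms keep the factor κ u⁻⁴, where κ ≠ 0.
  have := congrArg diag (h.rel_shift (-kappa n) i j k l)
  have hk : kappa n ≠ 0 := by
    simp only [kappa, neg_ne_zero, Nat.cast_ne_zero]; omega
  simp only [diag_sub, diag_uv_mul, diag_delta_mul, add_neg_cancel, neg_neg, neg_zero, zero_smul,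
    mul_zero, smul_zero, zero_sub, mul_smul_comm] at this
  have h0 := (smul_eq_zero.1 (neg_eq_zero.1 this.symm)).resolve_left hk
  exact sub_eq_zero.1 (X_mul_cancel (X_mul_cancel (X_mul_cancel (X_mul_cancel h0))))

/-- The defining relation with the variables exchanged. -/
theorem SatisfiesRTT.rel_swap (h : SatisfiesRTT t) (i j k l : Idx n) :
    delta A 0 * (delta A (-kappa n) * swap (superComm t t i j k l)) =
      uInv A * vInv A * (delta A 0 * (swap (crossLeft t t i j k l) -
          swap (crossRight t t i j k l))) -
      uInv A * vInv A * (delta A (-kappa n) * swap (permTerm t t i j k l)) := by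
  have := congrArg swap (h.rel i j k l)
  simp only [swap_sub, swap_uv_mul, swap_delta_mul, neg_zero, mul_neg, neg_neg] at this
  rw [this]
  abel

end Relations

/-! ### Transport of the relations from the free algebra to the Yangian -/

section Map

variable {A B : Type*} [Ring A] [Algebra ℂ A] [Ring B] [Algebra ℂ B] {n : ℕ}

theorem map_map_inU (h : A →+* B) (f : A⟦X⟧) :
    PowerSeries.map (PowerSeries.map h) (inU f) = inU (PowerSeries.map h f) := by
  simp [inU]

theorem map_map_inV (h : A →+* B) (f : A⟦X⟧) :
    PowerSeries.map (PowerSeries.map h) (inV f) = inV (PowerSeries.map h f) := by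
  ext s r
  simp only [inV, PowerSeries.coeff_map, PowerSeries.coeff_C]
  split_ifs <;> simp

theorem map_map_smul (h : A →ₐ[ℂ] B) (c : ℂ) (F : A⟦X⟧⟦X⟧) :
    PowerSeries.map (PowerSeries.map h.toRingHom) (c • F) =
      c • PowerSeries.map (PowerSeries.map h.toRingHom) F := by
  ext s r
  simp only [PowerSeries.coeff_map, coeff_complex_smul]
  exact map_smul h c _

theorem map_relLHS (h : A →ₐ[ℂ] B) (t : Idx n → Idx n → A⟦X⟧) (i j k l : Idx n) :
    PowerSeries.map (PowerSeries.map h.toRingHom) (relLHS t i j k l) =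
      relLHS (fun i j => PowerSeries.map h.toRingHom (t i j)) i j k l := by
  simp only [relLHS, map_mul, map_sub, map_map_smul, map_zsmul, uInv, vInv, map_map_inU,
    map_map_inV, PowerSeries.map_X]

theorem map_relRHS (h : A →ₐ[ℂ] B) (t : Idx n → Idx n → A⟦X⟧) (i j k l : Idx n) :
    PowerSeries.map (PowerSeries.map h.toRingHom) (relRHS t i j k l) =
      relRHS (fun i j => PowerSeries.map h.toRingHom (t i j)) i j k l := by
  simp only [relRHS, map_mul, map_sub, map_map_smul, map_zsmul, uInv, vInv, map_map_inU,
    map_map_inV, PowerSeries.map_X, apply_ite (PowerSeries.map (PowerSeries.map h.toRingHom)),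
    map_sum, map_zero]

theorem satisfiesRTT_T (n : ℕ) : SatisfiesRTT (T n) := by
  intro i j k l
  have : relLHS (T n) i j k l = PowerSeries.map (PowerSeries.map
      (RingQuot.mkAlgHom ℂ (Rel n)).toRingHom) (relLHS (freeT n) i j k l) := (map_relLHS _ _ _ _ _ _).symm
  rw [this]
  have : relRHS (T n) i j k l = PowerSeries.map (PowerSeries.map
      (RingQuot.mkAlgHom ℂ (Rel n)).toRingHom) (relRHS (freeT n) i j k l) := (map_relRHS _ _ _ _ _ _).symm
  rw [this]
  ext s r
  simp only [PowerSeries.coeff_map]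
  exact RingQuot.mkAlgHom_rel ℂ (Rel.rtt i j k l r s)

/-- An element commuting with the coefficients of all `t_ij(u)` is central. -/
theorem commute_of_commute_T {z : ExtYangian n}
    (h : ∀ i j r, PowerSeries.coeff r (T n i j) * z = z * PowerSeries.coeff r (T n i j))
    (a : ExtYangian n) : a * z = z * a := by
  obtain ⟨a, rfl⟩ := RingQuot.mkAlgHom_surjective ℂ (Rel n) a
  induction a using FreeAlgebra.induction with
  | grade0 c => rw [AlgHom.commutes]; exact Algebra.commutes c z
  | grade1 x =>
    obtain ⟨i, j, r⟩ := x
    have := h i j (r + 1)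
    simp only [T, freeT, PowerSeries.coeff_map, PowerSeries.coeff_mk] at this
    exact this
  | mul a b ha hb => rw [map_mul, mul_assoc, hb, ← mul_assoc, ha, mul_assoc]
  | add a b ha hb => rw [map_add, add_mul, mul_add, ha, hb]

end Map

/-! ### The scalar matrix T(u - κ) T^t(u) and the centrality of its entry -/

section Center

variable {A : Type*} [Ring A] [Algebra ℂ A] {n : ℕ}

theorem inV_mul (f g : A⟦X⟧) : inV (f * g) = inV f * inV g := by simp [inV]

theorem inV_zero : inV (0 : A⟦X⟧) = 0 := by simp [inV]

theorem inV_sum {ι : Type*} (t : Finset ι) (f : ι → A⟦X⟧) :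
    inV (∑ i ∈ t, f i) = ∑ i ∈ t, inV (f i) := by simp only [inV, map_sum]

theorem inV_zsmul (k : ℤ) (f : A⟦X⟧) : inV (k • f) = k • inV f := by
  simp only [inV, map_zsmul]

/-- The series `∑ θ_p t_{p1}(u) t_{p'1'}(u - κ)`. -/
noncomputable def centralSeries (t : Idx n → Idx n → A⟦X⟧) : A⟦X⟧ :=
  ∑ p : Idx n, theta p • (t p 0 * shift (-kappa n) (t p.rev (Fin.rev 0)))

theorem par_zero : par (0 : Idx n) = 0 := by simp [par]

theorem theta_zero : theta (0 : Idx n) = 1 := by simp [theta]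

theorem superTranspose_apply (t : Idx n → Idx n → A⟦X⟧) (i j : Idx n) :
    superTranspose t i j =
      ((-1 : ℤ) ^ (par i * par j + par j) * theta i * theta j) • t j.rev i.rev := rfl

variable {t : Idx n → Idx n → A⟦X⟧}

/-- Take `diag_cross` with first index m' and column indices 1 and 1'. The right cross sum is then,
up to sign, the (k,m) entry; the left one vanishes for k ≠ m and is the central series, up to sign,
for k = m. -/
theorem SatisfiesRTT.sum_mul_superTranspose (h : SatisfiesRTT t) (hn : 1 ≤ n) (k m : Idx n) :
    ∑ q, shift (-kappa n) (t k q) * superTranspose t q m =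
      if k = m then centralSeries t else 0 := by
  have key := h.diag_cross hn m.rev 0 k (Fin.rev 0)
  have hR : diag (crossRight t (fun i j => shift (-kappa n) (t i j)) m.rev 0 k (Fin.rev 0)) =
      ((-1 : ℤ) ^ (par m * par k + par m) * theta m) •
        ∑ q, shift (-kappa n) (t k q) * superTranspose t q m := by
    rw [crossRight, if_pos rfl, diag_sum, ← Equiv.sum_comp Fin.revPerm, Finset.smul_sum]
    refine Finset.sum_congr rfl fun q _ => ?_
    rw [Fin.revPerm_apply, diag_zsmul, Fin.rev_rev, diag_inV_mul_inU, superTranspose_apply,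
      mul_smul_comm, smul_smul]
    congr 1
    rw [theta_rev, par_rev, par_rev, par_zero, theta_zero]
    rcases par_eq_zero_or_one q with hq | hq <;> rcases par_eq_zero_or_one m with hm | hm <;>
      rcases theta_eq_one_or_neg_one m with h1 | h1 <;>
      rcases par_eq_zero_or_one k with hk | hk <;> simp [hq, hm, h1, hk]
  rw [hR] at key
  by_cases hkm : k = m
  · subst hkm
    rw [if_pos rfl]
    have hL : diag (crossLeft t (fun i j => shift (-kappa n) (t i j)) k.rev 0 k (Fin.rev 0)) =
        theta k • centralSeries t := by
      rw [crossLeft, if_pos (Fin.rev_rev k).symm, diag_sum, centralSeries, Finset.smul_sum]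
      refine Finset.sum_congr rfl fun q _ => ?_
      rw [diag_zsmul, diag_inU_mul_inV, smul_smul]
      congr 1
      rw [theta_rev, par_rev, par_zero]
      rcases par_eq_zero_or_one k with hk | hk <;> simp [hk]
    rw [hL] at key
    rcases par_eq_zero_or_one k with hk | hk <;> rcases theta_eq_one_or_neg_one k with h1 | h1 <;>
      simpa [hk, h1] using key.symm
  · rw [if_neg hkm]
    rw [crossLeft, Fin.rev_rev, if_neg hkm, diag_zero] at key
    rcases par_eq_zero_or_one k with hk | hk <;> rcases par_eq_zero_or_one m with hm | hm <;>
      rcases theta_eq_one_or_neg_one m with h1 | h1 <;>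
      simpa [hk, h1, hm] using key.symm

theorem SatisfiesRTT.commute_centralSeries (h : SatisfiesRTT t) (hn : 1 ≤ n) (i j : Idx n) :
    inU (t i j) * inV (centralSeries t) = inV (centralSeries t) * inU (t i j) := by
  -- The (k,k) entry does not depend on k; this choice removes the left cross term from both
  -- commutation relations below. It is possible because there are at least four indices.
  obtain ⟨k, hki, hki'⟩ : ∃ k : Idx n, k ≠ i ∧ k ≠ i.rev := by
    have h3 : ({i, i.rev} : Finset (Idx n)).card < Fintype.card (Idx n) :=
      lt_of_le_of_lt Finset.card_le_two (by simp; omega)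
    obtain ⟨k, hk⟩ := Finset.exists_mem_notMem_of_card_lt_card
      (s := {i, i.rev}) (t := Finset.univ) h3
    exact ⟨k, by simpa using hk.2⟩
  set s : Idx n → Idx n → A⟦X⟧ := fun i j => shift (-kappa n) (t i j) with hs
  have hM : ∀ k m : Idx n, ∑ q, inV (s k q) * inV (superTranspose t q m) =
      if k = m then inV (centralSeries t) else 0 := fun k m => by
    have := congrArg inV (h.sum_mul_superTranspose hn k m)
    rw [inV_sum, apply_ite inV, inV_zero] at this
    simpa only [inV_mul] using this
  set sg : Idx n → ℤ := fun (l : Idx n) => (-1 : ℤ) ^ (par l * par k + par k) * theta l * theta k with hsg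
  have hτ : ∀ l : Idx n, inV (superTranspose t l k) = sg l • inV (t k.rev l.rev) := fun (l : Idx n) => by
    rw [superTranspose_apply, inV_zsmul]
  have h1 : ∀ l : Idx n, delta A (-kappa n) * (delta A 0 * superComm t s i j k l) =
      uInv A * vInv A * (delta A 0 * permTerm t s i j k l) +
        uInv A * vInv A * (delta A (-kappa n) * crossRight t s i j k l) := fun (l : Idx n) => by
    have := h.rel_shift (-kappa n) i j k l
    rw [add_neg_cancel] at this
    rw [this, crossLeft, if_neg hki', zero_sub, mul_neg, mul_neg, sub_neg_eq_add]
  -- The exchanged form is used so that, after multiplication by `s k l` on the left, one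
  -- permutation term begins with two adjacent series in v, which sum to an entry of the scalar
  -- matrix.
  have h2 : ∀ l : Idx n, delta A (-kappa n) * (delta A 0 * swap (superComm t t k.rev l.rev i j)) =
      -(uInv A * vInv A * (delta A 0 * swap (crossRight t t k.rev l.rev i j))) -
      uInv A * vInv A * (delta A (-kappa n) * swap (permTerm t t k.rev l.rev i j)) := fun (l : Idx n) => by
    have := h.rel_swap k.rev l.rev i j
    rw [← mul_assoc, delta_comm, mul_assoc] at this
    rw [this, crossLeft, Fin.rev_rev, if_neg (Ne.symm hki), swap_zero, zero_sub, mul_neg, mul_neg]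
  have e0 : inU (t i j) * inV (centralSeries t) - inV (centralSeries t) * inU (t i j) =
      ∑ l, (superComm t s i j k l * inV (superTranspose t l k) -
        inV (s k l) * (sg l • swap (superComm t t k.rev l.rev i j))) := by
    have := hM k k
    rw [if_pos rfl] at this
    rw [← this, Finset.mul_sum, Finset.sum_mul, ← Finset.sum_sub_distrib]
    refine Finset.sum_congr rfl fun l _ => ?_
    rw [hτ, superComm, superComm, swap_sub, swap_zsmul, swap_inU_mul_inV, swap_inV_mul_inU,
      par_rev, par_rev, mul_comm (par k + par l)]
    simp only [sub_mul, mul_sub, smul_mul_assoc, mul_smul_comm, smul_sub, smul_smul, mul_assoc]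
    rw [mul_comm (sg l)]
    abel
  -- These are the terms with common factor `delta A 0`. Half of the permutation sum contains the
  -- (i,k) entry, zero since i ≠ k; the other half cancels the cross sum, concentrated at l = j.
  have e1 : ∑ l, permTerm t s i j k l * inV (superTranspose t l k) +
      ∑ l, inV (s k l) * (sg l • swap (crossRight t t k.rev l.rev i j)) = 0 := by
    have hz := hM i k
    rw [if_neg hki.symm] at hz
    have a1 : ∑ l, permTerm t s i j k l * inV (superTranspose t l k) =
        -∑ l, ((-1 : ℤ) ^ (par i * par j + par i * par k + par j * par k) * sg l) •
          (inV (s k j) * (inU (t i l) * inV (t k.rev l.rev))) := by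
      have : ∀ l : Idx n, permTerm t s i j k l * inV (superTranspose t l k) =
          ((-1 : ℤ) ^ (par i * par j + par i * par k + par j * par k)) •
            (inU (t k j) * (inV (s i l) * inV (superTranspose t l k))) -
          ((-1 : ℤ) ^ (par i * par j + par i * par k + par j * par k) * sg l) •
          (inV (s k j) * (inU (t i l) * inV (t k.rev l.rev))) := fun (l : Idx n) => by
        rw [permTerm, smul_mul_assoc, sub_mul, smul_sub, mul_assoc, mul_assoc, hτ]
        simp only [mul_smul_comm, smul_smul]
      simp only [this, Finset.sum_sub_distrib, ← Finset.smul_sum, ← Finset.mul_sum]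
      rw [hz, mul_zero, smul_zero, zero_sub]
    have a2 : ∑ l, inV (s k l) * (sg l • swap (crossRight t t k.rev l.rev i j)) =
        ∑ l, ((-1 : ℤ) ^ (par i * par j + par i * par k + par j * par k) * sg l) •
          (inV (s k j) * (inU (t i l) * inV (t k.rev l.rev))) := by
      rw [Finset.sum_eq_single j]
      · rw [crossRight, Fin.rev_rev, if_pos rfl, ← Equiv.sum_comp Fin.revPerm, swap_sum,
          Finset.smul_sum, Finset.mul_sum]
        refine Finset.sum_congr rfl fun l _ => ?_
        rw [Fin.revPerm_apply, Fin.rev_rev, swap_zsmul, swap_inV_mul_inU, smul_smul,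
          mul_smul_comm]
        congr 1
        simp only [hsg, theta_rev, par_rev]
        rcases par_eq_zero_or_one i with hi | hi <;> rcases par_eq_zero_or_one j with hj | hj <;>
          rcases par_eq_zero_or_one k with hk | hk <;>
          rcases par_eq_zero_or_one l with hl | hl <;>
          rcases theta_eq_one_or_neg_one j with h1 | h1 <;> simp [hi, hj, hk, hl, h1] <;> ring
      · intro l _ hl
        rw [crossRight, Fin.rev_rev, if_neg hl.symm, swap_zero, smul_zero, mul_zero]
      · simp
    rw [a1, a2, neg_add_cancel]
  -- The same cancellation for the factor `delta A (-kappa n)`: now the (k,i') entry is zero, and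
  -- the cross sum is concentrated at l = j'.
  have e2 : ∑ l, crossRight t s i j k l * inV (superTranspose t l k) +
      ∑ l, inV (s k l) * (sg l • swap (permTerm t t k.rev l.rev i j)) = 0 := by
    have hz := hM k i.rev
    rw [if_neg hki'] at hz
    have a1 : ∑ l, crossRight t s i j k l * inV (superTranspose t l k) =
        ∑ l, ((-1 : ℤ) ^ (par i * par k + par i * par l + par k) * theta l * theta k) •
          (inV (s k l) * (inU (t i l.rev) * inV (t k.rev j))) := by
      rw [Finset.sum_eq_single j.rev]
      · rw [crossRight, if_pos rfl, hτ, Fin.rev_rev, ← Equiv.sum_comp Fin.revPerm, Finset.sum_mul]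
        refine Finset.sum_congr rfl fun l _ => ?_
        rw [Fin.revPerm_apply, Fin.rev_rev, smul_mul_smul_comm, mul_assoc (inV _)]
        congr 1
        simp only [hsg, theta_rev, par_rev]
        rcases par_eq_zero_or_one i with hi | hi <;> rcases par_eq_zero_or_one j with hj | hj <;>
          rcases par_eq_zero_or_one k with hk | hk <;>
          rcases par_eq_zero_or_one l with hl | hl <;>
          rcases theta_eq_one_or_neg_one j with h1 | h1 <;> simp [hi, hj, hk, hl, h1]
      · intro l _ hl
        rw [crossRight, if_neg hl, zero_mul]
      · simp
    have a2 : ∑ l, inV (s k l) * (sg l • swap (permTerm t t k.rev l.rev i j)) =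
        -∑ l, ((-1 : ℤ) ^ (par i * par k + par i * par l + par k) * theta l * theta k) •
          (inV (s k l) * (inU (t i l.rev) * inV (t k.rev j))) := by
      have : ∀ l : Idx n, inV (s k l) * (sg l • swap (permTerm t t k.rev l.rev i j)) =
          ((-1 : ℤ) ^ (par i * par k + par k + par i) * theta i.rev * theta k) •
            (inV (s k l) * inV (superTranspose t l i.rev) * inU (t k.rev j)) -
          ((-1 : ℤ) ^ (par i * par k + par i * par l + par k) * theta l * theta k) •
          (inV (s k l) * (inU (t i l.rev) * inV (t k.rev j))) := fun (l : Idx n) => by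
        rw [permTerm, swap_zsmul, swap_sub, swap_inU_mul_inV, swap_inV_mul_inU, superTranspose_apply,
          inV_zsmul, Fin.rev_rev]
        simp only [mul_smul_comm, smul_mul_assoc, smul_smul, mul_sub, smul_sub, mul_assoc]
        congr 2
        · simp only [hsg, theta_rev, par_rev]
          rcases par_eq_zero_or_one i with hi | hi <;>
            rcases par_eq_zero_or_one k with hk | hk <;>
            rcases par_eq_zero_or_one l with hl | hl <;>
            rcases theta_eq_one_or_neg_one i with h1 | h1 <;>
            simp [hi, hk, hl, h1, mul_comm]
        · simp only [hsg, par_rev]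
          rcases par_eq_zero_or_one i with hi | hi <;>
            rcases par_eq_zero_or_one k with hk | hk <;>
            rcases par_eq_zero_or_one l with hl | hl <;> simp [hi, hk, hl]
      simp only [this, Finset.sum_sub_distrib, ← Finset.smul_sum, ← Finset.sum_mul]
      rw [hz, zero_mul, smul_zero, zero_sub]
    rw [a1, a2, add_neg_cancel]
  have e3 : delta A (-kappa n) * (delta A 0 * (inU (t i j) * inV (centralSeries t) -
      inV (centralSeries t) * inU (t i j))) = 0 := by
    calc _ = ∑ l, (delta A (-kappa n) * (delta A 0 * superComm t s i j k l) *
            inV (superTranspose t l k) - inV (s k l) * (sg l •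
              (delta A (-kappa n) * (delta A 0 * swap (superComm t t k.rev l.rev i j))))) := by
          rw [e0, Finset.mul_sum, Finset.mul_sum]
          refine Finset.sum_congr rfl fun l _ => ?_
          rw [mul_sub, mul_sub]
          simp only [mul_smul_comm, mul_assoc]
          rw [← mul_assoc (inV (s k l)), delta_comm, mul_assoc, ← mul_assoc (inV (s k l)) (delta A 0),
            delta_comm, mul_assoc]
      _ = ∑ l, (uInv A * vInv A * (delta A 0 * (permTerm t s i j k l *
              inV (superTranspose t l k) +
              inV (s k l) * (sg l • swap (crossRight t t k.rev l.rev i j)))) +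
            uInv A * vInv A * (delta A (-kappa n) * (crossRight t s i j k l *
              inV (superTranspose t l k) +
              inV (s k l) * (sg l • swap (permTerm t t k.rev l.rev i j))))) := by
          refine Finset.sum_congr rfl fun l _ => ?_
          rw [h1, h2]
          have hc : ∀ c F, inV (s k l) * (uInv A * vInv A * (delta A c * F)) =
              uInv A * vInv A * (delta A c * (inV (s k l) * F)) := fun c F => by
            rw [← mul_assoc, uv_comm, mul_assoc, ← mul_assoc (inV (s k l)), delta_comm,
              mul_assoc (delta A c)]
          rw [smul_sub, smul_neg, mul_sub, mul_neg, mul_smul_comm, mul_smul_comm, hc, hc, add_mul]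
          simp only [mul_smul_comm, mul_assoc, mul_add]
          abel
      _ = 0 := by
          rw [Finset.sum_add_distrib, ← Finset.mul_sum, ← Finset.mul_sum, ← Finset.mul_sum,
            ← Finset.mul_sum, Finset.sum_add_distrib, Finset.sum_add_distrib, e1, e2]
          simp
  exact sub_eq_zero.1 (delta_mul_cancel (delta_mul_cancel e3))

theorem coeff_centralSeries_comm (hn : 1 ≤ n) (r : ℕ) (a : ExtYangian n) :
    a * PowerSeries.coeff r (centralSeries (T n)) =
      PowerSeries.coeff r (centralSeries (T n)) * a := by
  refine commute_of_commute_T (fun i j q => ?_) a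
  have := congrArg (fun F => PowerSeries.coeff q (PowerSeries.coeff r F))
    ((satisfiesRTT_T n).commute_centralSeries hn i j)
  simpa only [coeff_coeff_inU_mul_inV, coeff_coeff_inV_mul_inU] using this

end Center

/-! ### The linear recurrence over a domain -/

section Recurrence

variable {R : Type*} [CommRing R] [IsDomain R]

/-- The linear recurrence satisfied by the matrix elements of `T^t(u) T(v)` and `T(v) T^t(u)` on
the highest vector, together with its consequence for the scalars `L j`. -/
theorem recurrence_consequence {D z : R} {L S S' s : ℕ → R} {a b : ℕ → ℕ → R} {N : ℕ}
    (hD : ∀ j, D - z * ∑ p ∈ Finset.range j, s p ≠ 0)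
    (hS : ∀ j ≤ N, S j = L j + ∑ p ∈ Finset.range j, s p * a p j)
    (hS' : ∀ j ≤ N, S' j = L j + ∑ p ∈ Finset.range j, b j p)
    (ha : ∀ j ≤ N, ∀ p < j, D * a p j = z * (S j - S' p))
    (hb : ∀ j ≤ N, ∀ p < j, D * b j p = s p * (z * (S' j - S p)))
    {j : ℕ} (hj : j + 1 ≤ N) :
    (D - z * ∑ p ∈ Finset.range (j + 1), s p) * a j (j + 1) = z * (L (j + 1) - L j) := by
  have eS : ∀ j ≤ N, (D - z * ∑ p ∈ Finset.range j, s p) * S j =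
      D * L j - z * ∑ p ∈ Finset.range j, s p * S' p := fun j hj => by
    have : D * ∑ p ∈ Finset.range j, s p * a p j =
        z * ((∑ p ∈ Finset.range j, s p) * S j - ∑ p ∈ Finset.range j, s p * S' p) := by
      rw [Finset.sum_mul, ← Finset.sum_sub_distrib, Finset.mul_sum, Finset.mul_sum]
      refine Finset.sum_congr rfl fun p hp => ?_
      linear_combination s p * ha j hj p (Finset.mem_range.1 hp)
    linear_combination D * hS j hj + this
  have eS' : ∀ j ≤ N, (D - z * ∑ p ∈ Finset.range j, s p) * S' j =
      D * L j - z * ∑ p ∈ Finset.range j, s p * S p := fun j hj => by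
    have : D * ∑ p ∈ Finset.range j, b j p =
        z * ((∑ p ∈ Finset.range j, s p) * S' j - ∑ p ∈ Finset.range j, s p * S p) := by
      rw [Finset.sum_mul, ← Finset.sum_sub_distrib, Finset.mul_sum, Finset.mul_sum]
      refine Finset.sum_congr rfl fun p hp => ?_
      linear_combination hb j hj p (Finset.mem_range.1 hp)
    linear_combination D * hS' j hj + this
  -- `S` and `S'` satisfy the same triangular system with their roles exchanged, and its leading
  -- coefficients are nonzero.
  have hSS : ∀ j ≤ N, S' j = S j := fun j => by
    induction j using Nat.strong_induction_on with
    | _ j ih =>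
      intro hj
      have : ∑ p ∈ Finset.range j, s p * S' p = ∑ p ∈ Finset.range j, s p * S p :=
        Finset.sum_congr rfl fun p hp => by
          rw [ih p (Finset.mem_range.1 hp) ((Finset.mem_range.1 hp).le.trans hj)]
      refine mul_left_cancel₀ (hD j) ?_
      rw [eS j hj, eS' j hj, this]
  have hD0 : D ≠ 0 := by simpa using hD 0
  refine mul_left_cancel₀ hD0 ?_
  -- The equations for j + 1 and j differ by one summand, so subtracting them isolates L (j + 1) - L
  -- j.
  have h1 := eS (j + 1) hj
  have h2 := eS j (by omega)
  rw [Finset.sum_range_succ, Finset.sum_range_succ, hSS j (by omega)] at h1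
  have h3 := ha (j + 1) hj j (by omega)
  rw [hSS j (by omega)] at h3
  rw [Finset.sum_range_succ]
  linear_combination (D - z * (∑ p ∈ Finset.range j, s p + s j)) * h3 + z * h1 - z * h2

end Recurrence

theorem delta_ne_zero (c : ℂ) : delta ℂ c ≠ 0 := fun h =>
  one_ne_zero (delta_mul_cancel (F := (1 : ℂ⟦X⟧⟦X⟧)) (by rw [h, zero_mul]))

/-- The leading coefficients of the recurrence are thus again of the form `delta`: the accumulated
signs only move the zero of u - v - κ. -/
theorem delta_sub_uv_mul_intCast (c : ℂ) (k : ℤ) :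
    delta ℂ c - uInv ℂ * vInv ℂ * (k : ℂ⟦X⟧⟦X⟧) = delta ℂ (c + k) := by
  rw [delta, delta, add_smul, Int.cast_smul_eq_zsmul, zsmul_eq_mul]
  ring

/-! ### Numbering of the first half of the indices -/

section Index

variable {n : ℕ}

/-- The index with a given number, counted from zero. -/
def ofNat (n m : ℕ) : Idx n := Fin.ofNat (2 * n + 2) m

theorem val_ofNat {m : ℕ} (hm : m ≤ 2 * n + 1) : (ofNat n m : ℕ) = m :=
  Nat.mod_eq_of_lt (by omega)

theorem par_ofNat_zero : par (ofNat n 0) = 0 := by simp [par, ofNat]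

theorem par_ofNat {m : ℕ} (h0 : 0 < m) (hm : m ≤ n) : par (ofNat n m) = 1 := by
  rw [par, val_ofNat (by omega), if_neg (by omega)]

theorem theta_ofNat {m : ℕ} (hm : m ≤ n) : theta (ofNat n m) = 1 := by
  rw [theta, val_ofNat (by omega), if_pos (Or.inl hm)]

theorem ofNat_lt_ofNat {a b : ℕ} (h : a < b) (hb : b ≤ 2 * n + 1) : ofNat n a < ofNat n b := by
  rw [Fin.lt_def, val_ofNat hb, val_ofNat (by omega)]; exact h

theorem ofNat_lt_rev {a b : ℕ} (ha : a ≤ n) (hb : b ≤ n) : ofNat n a < (ofNat n b).rev := by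
  rw [Fin.lt_def, Fin.val_rev, val_ofNat (by omega), val_ofNat (by omega)]; omega

theorem sum_eq_sum_range_ofNat {M : Type*} [AddCommMonoid M] {f : Idx n → M} {j : ℕ}
    (hj : j ≤ n) (hf : ∀ r, ofNat n j < r → f r = 0) :
    ∑ r, f r = ∑ m ∈ Finset.range (j + 1), f (ofNat n m) := by
  have h1 : ∑ r, f r = ∑ m ∈ Finset.range (2 * n + 2), f (ofNat n m) := by
    rw [← Fin.sum_univ_eq_sum_range (fun m => f (ofNat n m))]
    refine Finset.sum_congr rfl fun r _ => ?_
    congr 1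
    exact Fin.ext (val_ofNat (by omega)).symm
  rw [h1]
  refine (Finset.sum_subset (Finset.range_subset_range.2 (by omega)) fun m hm hm' => ?_).symm
  rw [Finset.mem_range] at hm hm'
  exact hf _ (ofNat_lt_ofNat (by omega) (by omega))

end Index

/-! ### Matrix elements on the highest vector -/

section HighestWeight

variable {n : ℕ} {V : Type*} [AddCommGroup V] [Module ℂ V] [Module (ExtYangian n) V]
  [IsScalarTower ℂ (ExtYangian n) V] {ξ : V} {lam : Idx n → ℂ⟦X⟧}

/-- The matrix element `a ↦ φ (a ξ)` of a module. -/
noncomputable def matrixElement (φ : V →ₗ[ℂ] ℂ) (ξ : V) : ExtYangian n →ₗ[ℂ] ℂ :=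
  φ ∘ₗ (LinearMap.toSpanSingleton (ExtYangian n) V ξ).restrictScalars ℂ

theorem matrixElement_apply (φ : V →ₗ[ℂ] ℂ) (ξ : V) (a : ExtYangian n) :
    matrixElement φ ξ a = φ (a • ξ) := rfl

theorem IsHighestVector.mapCoeff_inU_mul_inV_of_lt (h : IsHighestVector ξ lam)
    (φ : V →ₗ[ℂ] ℂ) (f : (ExtYangian n)⟦X⟧) {k l : Idx n} (hkl : k < l) :
    mapCoeff (matrixElement φ ξ) (inU f * inV (T n k l)) = 0 := by
  ext s r
  simp only [mapCoeff, PowerSeries.coeff_mk, coeff_coeff_inU_mul_inV, matrixElement_apply,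
    mul_smul, h.raising k l hkl, smul_zero, map_zero]

theorem IsHighestVector.mapCoeff_inV_mul_inU_of_lt (h : IsHighestVector ξ lam)
    (φ : V →ₗ[ℂ] ℂ) (f : (ExtYangian n)⟦X⟧) {k l : Idx n} (hkl : k < l) :
    mapCoeff (matrixElement φ ξ) (inV f * inU (T n k l)) = 0 := by
  ext s r
  simp only [mapCoeff, PowerSeries.coeff_mk, coeff_coeff_inV_mul_inU, matrixElement_apply,
    mul_smul, h.raising k l hkl, smul_zero, map_zero]

theorem IsHighestVector.mapCoeff_inU_mul_inV_diag (h : IsHighestVector ξ lam)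
    {φ : V →ₗ[ℂ] ℂ} (hφ : φ ξ = 1) (i k : Idx n) :
    mapCoeff (matrixElement φ ξ) (inU (T n i i) * inV (T n k k)) =
      inU (lam i) * inV (lam k) := by
  have := IsScalarTower.to_smulCommClass (R := ℂ) (A := ExtYangian n) (M := V)
  ext s r
  simp only [mapCoeff, PowerSeries.coeff_mk, coeff_coeff_inU_mul_inV, matrixElement_apply,
    mul_smul, h.diag]
  rw [← smul_comm, h.diag, map_smul, map_smul, hφ]
  simp [mul_comm]

theorem IsHighestVector.mapCoeff_inV_mul_inU_diag (h : IsHighestVector ξ lam)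
    {φ : V →ₗ[ℂ] ℂ} (hφ : φ ξ = 1) (i k : Idx n) :
    mapCoeff (matrixElement φ ξ) (inV (T n k k) * inU (T n i i)) =
      inU (lam i) * inV (lam k) := by
  have := IsScalarTower.to_smulCommClass (R := ℂ) (A := ExtYangian n) (M := V)
  ext s r
  simp only [mapCoeff, PowerSeries.coeff_mk, coeff_coeff_inU_mul_inV, coeff_coeff_inV_mul_inU,
    matrixElement_apply, mul_smul, h.diag]
  rw [← smul_comm, h.diag, map_smul, map_smul, hφ]
  simp

/-- Here j = i - 1. Keeping p, q ≤ n (counted from zero) ensures θ = 1 and p < q', so that both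
products in the permutation term end in a raising operator. -/
theorem IsHighestVector.consistency (h : IsHighestVector ξ lam) {j : ℕ} (hj : j + 1 ≤ n) :
    lam (ofNat n j) * shift ((n : ℂ) - j + 1) (lam (ofNat n j).rev) =
      lam (ofNat n (j + 1)) * shift ((n : ℂ) - j + 1) (lam (ofNat n (j + 1)).rev) := by
  obtain ⟨φ, hφ⟩ := Module.Projective.exists_dual_eq_one ℂ h.ne_zero
  set Φ := mapCoeff (matrixElement (n := n) φ ξ) with hΦ
  set e : ℕ → Idx n := ofNat n with he
  -- This is minus the parity sign: -1 for the even first index, +1 for the odd ones, so its sum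
  -- over 0, …, j is j - 1.
  set sg : ℕ → ℤ := fun m => if m = 0 then -1 else 1 with hsg
  set L : ℕ → ℂ⟦X⟧⟦X⟧ := fun m => inU (lam (e m)) * inV (lam (e m).rev) with hL
  set a : ℕ → ℕ → ℂ⟦X⟧⟦X⟧ := fun p q =>
    Φ (inU (T n (e p) (e q)) * inV (T n (e p).rev (e q).rev)) with ha
  set b : ℕ → ℕ → ℂ⟦X⟧⟦X⟧ := fun p q =>
    Φ (inV (T n (e p).rev (e q).rev) * inU (T n (e p) (e q))) with hb
  -- Up to a common sign, `S q` and `S' p` are the matrix elements of the left and right cross sums: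
  -- later summands end in raising operators, and the diagonal one gives `L`.
  set S : ℕ → ℂ⟦X⟧⟦X⟧ := fun m => L m + ∑ p ∈ Finset.range m, (sg p : ℂ⟦X⟧⟦X⟧) * a p m with hS
  set S' : ℕ → ℂ⟦X⟧⟦X⟧ := fun m => L m + ∑ p ∈ Finset.range m, b m p with hS'
  have par_sg : ∀ m ≤ n, (-1 : ℤ) ^ par (e m) = - sg m := fun m hm => by
    rcases Nat.eq_zero_or_pos m with rfl | h0
    · simp [he, hsg, par_ofNat_zero]
    · simp [he, hsg, par_ofNat h0 hm, h0.ne']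
  have hleft : ∀ p q, p ≤ n → q ≤ n →
      Φ (crossLeft (T n) (T n) (e p) (e q) (e p).rev (e q).rev) =
        ((-1 : ℤ) ^ (par (e p) + par (e p) * par (e q) + par (e q))) • S q := by
    intro p q hp hq
    unfold crossLeft
    rw [if_pos rfl, hΦ, mapCoeff_sum, sum_eq_sum_range_ofNat hq, Finset.sum_range_succ,
      hS, smul_add, add_comm, Finset.smul_sum]
    · congr 1
      · rw [mapCoeff_zsmul, h.mapCoeff_inU_mul_inV_diag hφ, theta_ofNat hp, theta_ofNat hq]
        congr 1
        rcases par_eq_zero_or_one (e q) with h1 | h1 <;> simp [← he, h1]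
      · refine Finset.sum_congr rfl fun r hr => ?_
        have hrq := Finset.mem_range.1 hr
        rw [mapCoeff_zsmul, theta_ofNat hp, theta_ofNat (by omega : r ≤ n), ← zsmul_eq_mul,
          smul_smul]
        congr 1
        have hs := par_sg r (by omega)
        have hq1 : par (e q) = 1 := par_ofNat (by omega) hq
        have hs' : sg r = -(-1 : ℤ) ^ par (e r) := by rw [hs, neg_neg]
        rw [hs', ← he, hq1]
        ring
    · intro r hr
      rw [mapCoeff_zsmul, h.mapCoeff_inU_mul_inV_of_lt φ _ (Fin.rev_lt_rev.2 hr), smul_zero]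
  have hright : ∀ p q, p ≤ n → q ≤ n →
      Φ (crossRight (T n) (T n) (e p) (e q) (e p).rev (e q).rev) =
        ((-1 : ℤ) ^ (par (e p) + par (e p) * par (e q) + par (e q))) • S' p := by
    intro p q hp hq
    unfold crossRight
    rw [if_pos rfl, hΦ, mapCoeff_sum, sum_eq_sum_range_ofNat hp, Finset.sum_range_succ,
      hS', smul_add, add_comm, Finset.smul_sum]
    · congr 1
      · rw [mapCoeff_zsmul, h.mapCoeff_inV_mul_inU_diag hφ, theta_ofNat hp, theta_ofNat hq, par_rev]
        congr 1
        rcases par_eq_zero_or_one (e p) with h1 | h1 <;>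
          rcases par_eq_zero_or_one (e q) with h2 | h2 <;> simp [← he, h1, h2]
      · refine Finset.sum_congr rfl fun r hr => ?_
        have hrq := Finset.mem_range.1 hr
        rw [mapCoeff_zsmul, theta_ofNat hq, theta_ofNat (by omega : r ≤ n), par_rev]
        congr 1
        have hp1 : par (e p) = 1 := par_ofNat (by omega) hp
        rw [← he, hp1]
        rcases par_eq_zero_or_one (e r) with h1 | h1 <;>
          rcases par_eq_zero_or_one (e q) with h2 | h2 <;> simp [h1, h2]
    · intro r hr
      rw [mapCoeff_zsmul, h.mapCoeff_inV_mul_inU_of_lt φ _ hr, smul_zero]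
  have hrel : ∀ p q, p ≤ n → q ≤ n → delta ℂ (kappa n) * (a p q -
      ((-1 : ℤ) ^ ((par (e p) + par (e q)) * (par (e p) + par (e q)))) • b p q) =
      -(uInv ℂ * vInv ℂ * (((-1 : ℤ) ^ (par (e p) + par (e p) * par (e q) + par (e q))) •
        (S q - S' p))) := by
    intro p q hp hq
    have := congrArg Φ ((satisfiesRTT_T n).rel (e p) (e q) (e p).rev (e q).rev)
    rw [hΦ, mapCoeff_sub, mapCoeff_delta_mul, mapCoeff_delta_mul] at this
    simp only [mul_assoc (uInv (ExtYangian n)), mapCoeff_uInv_mul, mapCoeff_vInv_mul,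
      mapCoeff_delta_mul, mapCoeff_sub] at this
    rw [← hΦ, hleft p q hp hq, hright p q hp hq, ← smul_sub] at this
    have hperm : Φ (permTerm (T n) (T n) (e p) (e q) (e p).rev (e q).rev) = 0 := by
      unfold permTerm
      rw [hΦ, mapCoeff_zsmul, mapCoeff_sub,
        h.mapCoeff_inU_mul_inV_of_lt φ _ (ofNat_lt_rev hp hq),
        h.mapCoeff_inV_mul_inU_of_lt φ _ (ofNat_lt_rev hp hq), sub_zero, smul_zero]
    unfold superComm at this
    rw [hperm, hΦ, mapCoeff_sub, mapCoeff_zsmul, par_rev, par_rev] at this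
    refine mul_left_cancel₀ (delta_ne_zero 0) (this.trans ?_)
    ring
  -- For p ≠ q one of the two products in the supercommutator ends in a raising operator, so each
  -- relation determines a single unknown.
  have b_eq_zero : ∀ q ≤ n, ∀ p < q, b p q = 0 := fun q hq p hpq =>
    h.mapCoeff_inV_mul_inU_of_lt φ _ (ofNat_lt_ofNat hpq (by omega))
  have a_eq_zero : ∀ q ≤ n, ∀ p < q, a q p = 0 := fun q hq p hpq =>
    h.mapCoeff_inU_mul_inV_of_lt φ _ (Fin.rev_lt_rev.2 (ofNat_lt_ofNat hpq (by omega)))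
  have key := recurrence_consequence (D := delta ℂ (kappa n)) (z := uInv ℂ * vInv ℂ)
    (L := L) (S := S) (S' := S') (s := fun m => (sg m : ℂ⟦X⟧⟦X⟧)) (a := a) (b := b) (N := n)
    (fun m => by
      rw [← Int.cast_sum, delta_sub_uv_mul_intCast]
      exact delta_ne_zero _)
    (fun _ _ => rfl) (fun _ _ => rfl)
    (fun q hq p hpq => by
      have := hrel p q (by omega) hq
      rw [b_eq_zero q hq p hpq, smul_zero, sub_zero,
        par_ofNat (by omega : 0 < q) hq] at this
      rw [this]
      rcases par_eq_zero_or_one (e p) with h1 | h1 <;> simp [h1] <;> ring)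
    (fun q hq p hpq => by
      have := hrel q p hq (by omega)
      have hs := par_sg p (by omega)
      have hs' : sg p = -(-1 : ℤ) ^ par (e p) := by rw [hs, neg_neg]
      rw [a_eq_zero q hq p hpq, zero_sub, par_ofNat (by omega : 0 < q) hq] at this
      rw [hs']
      rcases par_eq_zero_or_one (e p) with h1 | h1 <;> simp [h1] at this ⊢ <;>
        linear_combination this)
    hj
  have hsum : ∑ p ∈ Finset.range (j + 1), sg p = (j : ℤ) - 1 := by
    rw [Finset.sum_range_succ']
    simp [hsg, sub_eq_add_neg]
  rw [← Int.cast_sum, delta_sub_uv_mul_intCast, hsum] at key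
  -- The coefficient on the left is u - v - (κ + j - 1), up to u⁻¹v⁻¹; it vanishes exactly at v = u
  -- + n - j + 1.
  have h2 := congrArg (fun F => OspYangian.diag (nu ℂ ((n : ℂ) - j + 1) * shift ((n : ℂ) - j + 1) F)) key
  simp only [nu_mul_shift_delta_mul, nu_mul_shift_uv_mul, diag_uv_mul, diag_delta_mul] at h2
  rw [show -(kappa n + (((j : ℤ) - 1 : ℤ) : ℂ) + ((n : ℂ) - j + 1)) = 0 by
    simp only [kappa]; push_cast; ring, zero_smul] at h2
  have h3 := X_mul_cancel (X_mul_cancel h2.symm)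
  simp only [hL, shift_sub, shift_inU_mul_inV, diag_sub, diag_inU_mul_inV] at h3
  exact (sub_eq_zero.1 h3).symm

theorem coeff_shift_smul_eq {f : (ExtYangian n)⟦X⟧} {g : ℂ⟦X⟧}
    (h : ∀ r, PowerSeries.coeff r f • ξ = PowerSeries.coeff r g • ξ) (a : ℂ) (r : ℕ) :
    PowerSeries.coeff r (shift a f) • ξ = PowerSeries.coeff r (shift a g) • ξ := by
  simp only [shift, PowerSeries.coeff_mk, Finset.sum_smul, smul_assoc, h]

theorem IsHighestVector.coeff_centralSeries_smul (h : IsHighestVector ξ lam) (r : ℕ) :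
    PowerSeries.coeff r (centralSeries (T n)) • ξ =
      PowerSeries.coeff r (lam 0 * shift n (lam (Fin.rev 0))) • ξ := by
  have := IsScalarTower.to_smulCommClass (R := ℂ) (A := ExtYangian n) (M := V)
  have hterm : ∀ p : Idx n, p ≠ 0 → PowerSeries.coeff r
      (theta p • (T n p 0 * shift (-kappa n) (T n p.rev (Fin.rev 0)))) • ξ = 0 := fun p hp => by
    have hlt : p.rev < Fin.rev 0 := Fin.rev_lt_rev.2 (Fin.pos_iff_ne_zero.2 hp)
    have h0 := coeff_shift_smul_eq (ξ := ξ) (f := T n p.rev (Fin.rev 0)) (g := 0)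
      (fun r => by rw [h.raising _ _ hlt, map_zero, zero_smul]) (-kappa n)
    simp only [shift_zero, map_zero, zero_smul] at h0
    simp only [map_zsmul, PowerSeries.coeff_mul, smul_assoc, Finset.sum_smul, mul_smul, h0,
      smul_zero, Finset.sum_const_zero]
  unfold centralSeries
  rw [map_sum, Finset.sum_smul, Finset.sum_eq_single 0 (fun p _ => hterm p)
    (by simp), theta_zero, one_smul, PowerSeries.coeff_mul, PowerSeries.coeff_mul,
    Finset.sum_smul, Finset.sum_smul]
  refine Finset.sum_congr rfl fun p _ => ?_
  rw [mul_smul, coeff_shift_smul_eq (h.diag (Fin.rev 0)), ← smul_comm, h.diag, smul_smul, kappa,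
    neg_neg, mul_comm]

/-- Every vector is a ξ for some a in the algebra, and the central coefficient passes through a. -/
theorem IsHighestVector.coeff_centralSeries_smul_eq (h : IsHighestVector ξ lam) (hn : 1 ≤ n)
    (r : ℕ) (w : V) :
    PowerSeries.coeff r (centralSeries (T n)) • w =
      PowerSeries.coeff r (lam 0 * shift n (lam (Fin.rev 0))) • w := by
  have := IsScalarTower.to_smulCommClass (R := ℂ) (A := ExtYangian n) (M := V)
  have hw : w ∈ Submodule.span (ExtYangian n) {ξ} := by rw [h.span_eq_top]; trivial
  obtain ⟨a, rfl⟩ := Submodule.mem_span_singleton.1 hw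
  rw [← mul_smul, ← coeff_centralSeries_comm hn, mul_smul, h.coeff_centralSeries_smul, smul_comm]

end HighestWeight
end OspYangian

theorem proposition2p2 (n : ℕ) (hn : 1 ≤ n)
    {V : Type*} [AddCommGroup V] [Module ℂ V] [Module (OspYangian.ExtYangian n) V]
    [IsScalarTower ℂ (OspYangian.ExtYangian n) V]
    (ξ : V) (lam : OspYangian.Idx n → PowerSeries ℂ)
    (hξ : OspYangian.IsHighestVector ξ lam) :
    (∀ (i : ℕ) (h1 : 1 ≤ i) (h2 : i ≤ n),
      lam (OspYangian.idx i (by omega)) *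
          OspYangian.shift ((n : ℂ) - (i : ℂ) + 2) (lam (OspYangian.idx i (by omega)).rev) =
        lam (OspYangian.idx (i + 1) (by omega)) *
          OspYangian.shift ((n : ℂ) - (i : ℂ) + 2)
            (lam (OspYangian.idx (i + 1) (by omega)).rev)) ∧
    ∃ c : PowerSeries (OspYangian.ExtYangian n),
      (OspYangian.T n).map (OspYangian.shift (-OspYangian.kappa n)) *
          OspYangian.superTranspose (OspYangian.T n) = Matrix.diagonal (fun _ => c) ∧
      ∀ (r : ℕ) (w : V),
        PowerSeries.coeff r c • w =
          PowerSeries.coeff r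
            (lam (OspYangian.idx 1 (by omega)) *
              OspYangian.shift (n : ℂ) (lam (OspYangian.idx 1 (by omega)).rev)) • w := by
  refine ⟨fun i h1 h2 => ?_, OspYangian.centralSeries (OspYangian.T n), ?_,
    fun r w => hξ.coeff_centralSeries_smul_eq hn r w⟩
  · obtain ⟨j, rfl⟩ : ∃ j, i = j + 1 := ⟨i - 1, by omega⟩
    have e : ∀ m (hm : m ≤ n), OspYangian.idx (n := n) (m + 1) (by omega) =
        OspYangian.ofNat n m := fun m hm =>
      Fin.ext (OspYangian.val_ofNat (n := n) (by omega)).symm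
    have := hξ.consistency h2
    rw [e j (by omega), e (j + 1) h2]
    convert this using 3 <;> push_cast <;> ring
  · ext1 k m
    rw [Matrix.mul_apply, Matrix.diagonal_apply]
    exact (OspYangian.satisfiesRTT_T n).sum_mul_superTranspose hn k m
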